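/- Let $n\ge 1$, let $\mathbf M=\{A_1,\dots,A_N\}\subset\mathbb R^{n\times n}$ be a finite family of matrices, and let $\mathbf G=(V,E)$ be a directed graph with a finite set $V$ of nodes, each of whose edges $(v,w,\sigma)\in E\subseteq V\times V\times\{1,\dots,N\}$ goes from $v$ to $w$ and carries a label $\sigma$. For a path $p$ of $\mathbf G$ of length $|p|=t$ (a sequence of $t$ consecutive edges) with successive labels $\sigma(0),\dots,\sigma(t-1)$ put $A_p=A_{\sigma(t-1)}\cdots A_{\sigma(0)}$, and let $$\hat\rho(\mathbf G,\mathbf M)=\lim_{t\to\infty}\max\{\|A_p\|^{1/t} : p \text{ a path of } \mathbf G,\ |p|=t\}$$ be the constrained joint spectral radius of the system $S(\mathbf G,\mathbf M)$, where $\|\cdot\|$ is the matrix norm induced by the Euclidean norm and the maximum is read as $0$ if there is no path of length $t$ (the limit always exists). For $\gamma\in\mathbb R$, a quadratic $\gamma$-multinorm of $S(\mathbf G,\mathbf M)$ is a family $(|\cdot|_v)_{v\in V}$ of norms on $\mathbb R^n$ of the form $|x|_v=\sqrt{x^{\top}Q_vx}$, with $Q_v$ symmetric positive definite, such that $|A_\sigma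 x|_w\le\gamma|x|_v$ for every edge $(v,w,\sigma)\in E$ and every $x\in\mathbb R^n$. A quadratic Lyapunov multinorm is a quadratic $\gamma$-multinorm with $\gamma<1$. If $\hat\rho(\mathbf G,\mathbf M)<1/\sqrt n$, then $S(\mathbf G,\mathbf M)$ admits a quadratic Lyapunov multinorm. Moreover, without any assumption on $\hat\rho(\mathbf G,\mathbf M)$, for every $\varepsilon>0$ there is a real $\gamma\le\sqrt n\,(\hat\rho(\mathbf G,\mathbf M)+\varepsilon)$ such that $S(\mathbf G,\mathbf M)$ admits a quadratic $\gamma$-multinorm. -/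

import Mathlib

open Filter Topology Matrix

/-- A directed graph on the node set `V` whose edges carry labels in `{1, …, N}` (here `Fin N`).
An edge `(v, w, σ)` goes from `v` to `w` and carries the label `σ`; parallel edges with different
labels and self-loops are allowed. -/
structure LabeledGraph (V : Type*) (N : ℕ) where
  edges : Set (V × V × Fin N)

namespace LabeledGraph

variable {V : Type*} {N n : ℕ}

/-- A path: a sequence of consecutive edges (the target of each edge is the source of the next).
Its length is the length of the list. -/
def IsPath (G : LabeledGraph V N) (p : List (V × V × Fin N)) : Prop :=
  (∀ e ∈ p, e ∈ G.edges) ∧ p.IsChain (fun e f => e.2.1 = f.1)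

end LabeledGraph

namespace Switching

variable {V : Type*} {N n : ℕ}

/-- The matrix product `A_p = A_{σ(t-1)} ⋯ A_{σ(0)}` associated with a path `p` carrying the
successive labels `σ(0), …, σ(t-1)`. -/
def pathMatrix (A : Fin N → Matrix (Fin n) (Fin n) ℝ) (p : List (V × V × Fin N)) :
    Matrix (Fin n) (Fin n) ℝ :=
  ((p.map fun e => A e.2.2).reverse).prod

/-- The matrix norm induced by the Euclidean norm of `ℝⁿ`. -/
noncomputable def inducedNorm (A : Matrix (Fin n) (Fin n) ℝ) : ℝ :=
  ‖Matrix.toEuclideanCLM (n := Fin n) (𝕜 := ℝ) A‖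

/-- `ρ̂_t(G, M) = max {‖A_p‖ ^ (1 / t) : p a path of G, |p| = t}`. For finitely many nodes this is
the supremum of a finite set; it is `0` if `G` has no path of length `t`. -/
noncomputable def growthRate (G : LabeledGraph V N) (A : Fin N → Matrix (Fin n) (Fin n) ℝ)
    (t : ℕ) : ℝ :=
  sSup {r : ℝ | ∃ p : List (V × V × Fin N), G.IsPath p ∧ p.length = t ∧
    r = inducedNorm (pathMatrix A p) ^ (1 / (t : ℝ))}

/-- The constrained joint spectral radius `ρ̂(G, M) = lim_{t → ∞} ρ̂_t(G, M)`.
The limit exists, see `tendsto_growthRate_cjsr`. -/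
noncomputable def cjsr (G : LabeledGraph V N) (A : Fin N → Matrix (Fin n) (Fin n) ℝ) : ℝ :=
  limUnder atTop (growthRate G A)

/-- A `γ`-multinorm of the system `S(G, M)`: one norm on `ℝⁿ` for each node (a norm is a seminorm
vanishing only at `0`) such that `|A_σ x|_w ≤ γ |x|_v` for every edge `(v, w, σ)` and all `x`. -/
def IsMultinorm (G : LabeledGraph V N) (A : Fin N → Matrix (Fin n) (Fin n) ℝ) (γ : ℝ)
    (ν : V → Seminorm ℝ (Fin n → ℝ)) : Prop :=
  (∀ v x, ν v x = 0 → x = 0) ∧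
    ∀ v w σ, (v, w, σ) ∈ G.edges → ∀ x : Fin n → ℝ, ν w (A σ *ᵥ x) ≤ γ * ν v x

/-- A quadratic norm: `|x| = √(xᵀ Q x)` for some symmetric positive definite `Q`. -/
def IsQuadraticNorm (ν : Seminorm ℝ (Fin n → ℝ)) : Prop :=
  ∃ Q : Matrix (Fin n) (Fin n) ℝ, Q.PosDef ∧ ∀ x, ν x = √(x ⬝ᵥ (Q *ᵥ x))

/-- A quadratic `γ`-multinorm is a `γ`-multinorm that consists of quadratic norms. -/
def IsQuadraticMultinorm (G : LabeledGraph V N) (A : Fin N → Matrix (Fin n) (Fin n) ℝ) (γ : ℝ)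
    (ν : V → Seminorm ℝ (Fin n → ℝ)) : Prop :=
  IsMultinorm G A γ ν ∧ ∀ v, IsQuadraticNorm (ν v)

/-- A quadratic Lyapunov multinorm is a quadratic `γ`-multinorm with `γ < 1`. -/
def IsQuadraticLyapunovMultinorm (G : LabeledGraph V N) (A : Fin N → Matrix (Fin n) (Fin n) ℝ)
    (ν : V → Seminorm ℝ (Fin n → ℝ)) : Prop :=
  ∃ γ : ℝ, γ < 1 ∧ IsQuadraticMultinorm G A γ ν

/-! Existence of the limit that defines the constrained joint spectral radius. -/

/-- A form of Fekete's lemma. -/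
theorem exists_tendsto_rpow_of_submultiplicative (a : ℕ → ℝ) (h0 : ∀ t, 0 ≤ a t)
    (hmul : ∀ s t, a (s + t) ≤ a s * a t) :
    ∃ L, Tendsto (fun t : ℕ => a t ^ (1 / (t : ℝ))) atTop (𝓝 L) := by
  by_cases hz : ∃ t, a t = 0
  · obtain ⟨t, ht⟩ := hz
    refine ⟨0, tendsto_const_nhds.congr' ?_⟩
    filter_upwards [eventually_ge_atTop t, eventually_ge_atTop 1] with s hs hs1
    have h1 := hmul t (s - t)
    rw [ht, zero_mul, Nat.add_sub_cancel' hs] at h1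
    rw [le_antisymm h1 (h0 s), Real.zero_rpow]
    positivity
  · push Not at hz
    have hpos : ∀ t, 0 < a t := fun t => lt_of_le_of_ne (h0 t) (hz t).symm
    have hsub : Subadditive fun t => Real.log (a t) := by
      intro s t
      rw [← Real.log_mul (hz s) (hz t)]
      exact Real.log_le_log (hpos _) (hmul s t)
    have hexp : ∀ t : ℕ, a t ^ (1 / (t : ℝ)) = Real.exp (Real.log (a t) / t) := by
      intro t
      rw [Real.rpow_def_of_pos (hpos t), mul_one_div]
    simp_rw [hexp]
    by_cases hb : BddBelow (Set.range fun t : ℕ => Real.log (a t) / t)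
    · exact ⟨_, (Real.continuous_exp.tendsto _).comp (hsub.tendsto_lim hb)⟩
    · refine ⟨0, Real.tendsto_exp_atBot.comp ?_⟩
      rw [tendsto_atBot]
      intro b
      rw [not_bddBelow_iff] at hb
      obtain ⟨_, ⟨t, rfl⟩, ht⟩ := hb (min b 0)
      have ht0 : t ≠ 0 := by
        rintro rfl
        simp at ht
      exact (hsub.eventually_div_lt_of_div_lt ht0 (lt_of_lt_of_le ht (min_le_left _ _))).mono
        fun _ h => h.le

theorem inducedNorm_mul_le (A B : Matrix (Fin n) (Fin n) ℝ) :
    inducedNorm (A * B) ≤ inducedNorm A * inducedNorm B := by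
  unfold inducedNorm
  rw [map_mul]
  exact norm_mul_le _ _

/-- The limit that defines the constrained joint spectral radius exists. -/
theorem tendsto_growthRate_cjsr [Finite V] (G : LabeledGraph V N)
    (A : Fin N → Matrix (Fin n) (Fin n) ℝ) :
    Tendsto (growthRate G A) atTop (𝓝 (cjsr G A)) := by
  set P : ℕ → Set (List (V × V × Fin N)) := fun t => {p | G.IsPath p ∧ p.length = t} with hP
  have hPf : ∀ t, (P t).Finite := fun t =>
    (List.finite_length_eq (V × V × Fin N) t).subset fun p hp => hp.2
  set f : List (V × V × Fin N) → ℝ := fun p => inducedNorm (pathMatrix A p) with hf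
  have hf0 : ∀ p, 0 ≤ f p := fun p => norm_nonneg _
  set a : ℕ → ℝ := fun t => sSup (f '' P t) with ha
  have hle : ∀ t, ∀ p ∈ P t, f p ≤ a t := fun t p hp =>
    le_csSup ((hPf t).image f).bddAbove ⟨p, hp, rfl⟩
  have ha0 : ∀ t, 0 ≤ a t := fun t => Real.sSup_nonneg (by rintro _ ⟨p, -, rfl⟩; exact hf0 p)
  have hmul : ∀ s t, a (s + t) ≤ a s * a t := by
    intro s t
    refine Real.sSup_le ?_ (mul_nonneg (ha0 s) (ha0 t))
    rintro _ ⟨p, ⟨⟨hpe, hpc⟩, hpl⟩, rfl⟩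
    have h1 : p.take s ∈ P s :=
      ⟨⟨fun e he => hpe e (List.mem_of_mem_take he), hpc.take s⟩, by simp [hpl]⟩
    have h2 : p.drop s ∈ P t :=
      ⟨⟨fun e he => hpe e (List.mem_of_mem_drop he), hpc.drop s⟩, by simp [hpl]⟩
    have h3 : pathMatrix A p = pathMatrix A (p.drop s) * pathMatrix A (p.take s) := by
      conv_lhs => rw [← List.take_append_drop s p]
      simp only [pathMatrix, List.map_append, List.reverse_append, List.prod_append]
    calc f p ≤ f (p.drop s) * f (p.take s) := by
          simp only [hf, h3]; exact inducedNorm_mul_le _ _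
      _ ≤ a t * a s := mul_le_mul (hle _ _ h2) (hle _ _ h1) (hf0 _) (ha0 t)
      _ = a s * a t := mul_comm _ _
  have hgr : ∀ t : ℕ, 1 ≤ t → growthRate G A t = a t ^ (1 / (t : ℝ)) := by
    intro t ht
    have hset : {r : ℝ | ∃ p : List (V × V × Fin N), G.IsPath p ∧ p.length = t ∧
        r = inducedNorm (pathMatrix A p) ^ (1 / (t : ℝ))}
        = (fun p => f p ^ (1 / (t : ℝ))) '' P t := by
      ext r
      constructor
      · rintro ⟨p, h1, h2, rfl⟩
        exact ⟨p, ⟨h1, h2⟩, rfl⟩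
      · rintro ⟨p, ⟨h1, h2⟩, rfl⟩
        exact ⟨p, h1, h2, rfl⟩
    unfold growthRate
    rw [hset]
    rcases (P t).eq_empty_or_nonempty with he | hne
    · have hne0 : (1 / (t : ℝ)) ≠ 0 := by positivity
      simp only [ha, he, Set.image_empty, Real.sSup_empty, Real.zero_rpow hne0]
    · apply le_antisymm
      · refine Real.sSup_le ?_ (Real.rpow_nonneg (ha0 t) _)
        rintro _ ⟨p, hp, rfl⟩
        exact Real.rpow_le_rpow (hf0 p) (hle t p hp) (by positivity)
      · obtain ⟨p, hp, hpa⟩ := (hne.image f).csSup_mem ((hPf t).image f)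
        have hpa' : a t = f p := hpa.symm
        rw [hpa']
        exact le_csSup ((hPf t).image _).bddAbove ⟨p, hp, rfl⟩
  obtain ⟨L, hL⟩ := exists_tendsto_rpow_of_submultiplicative a ha0 hmul
  refine tendsto_nhds_limUnder ⟨L, hL.congr' ?_⟩
  filter_upwards [eventually_ge_atTop 1] with t ht
  exact (hgr t ht).symm

end Switching

/-! For `γ` above the constrained joint spectral radius, let `|x|_v` be the supremum of `‖A_p x‖ / γ
^ |p|` over the paths `p` that start at `v`. It is finite because path products are `O(γ ^ |p|)`,
definite because of the empty path, and it satisfies the edge inequality because a path from `w`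
preceded by an edge `(v, w, σ)` is a path from `v`. This multinorm is in general not quadratic.
John's theorem gives for each node a quadratic `q` with `q ≤ |·|_v ≤ √n q`, so the edge inequality
survives with `√n γ`. It remains to take `γ = ρ̂ + ε`, or `γ` strictly between `ρ̂` and `1 / √n`.
John's theorem is proved variationally: if the smallest ellipsoid around the unit ball were too
large in some direction, squeezing it there would reduce its volume. -/

/-! ### Norms on a finite-dimensional space and John's theorem -/

/-- Hahn–Banach: the functional `c • x₀ ↦ c * p x₀` extends from the line through `x₀` under the
bound `p`. Geometrically, `y` spans a slab containing the unit ball of `p` and supporting it in the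
direction `x₀`. -/
theorem Seminorm.exists_dotProduct_eq_and_le {ι : Type*} [Fintype ι] (p : Seminorm ℝ (ι → ℝ))
    (x₀ : ι → ℝ) : ∃ y : ι → ℝ, y ⬝ᵥ x₀ = p x₀ ∧ ∀ x, |y ⬝ᵥ x| ≤ p x := by
  classical
  obtain ⟨g, hg, hgp⟩ : ∃ g : (ι → ℝ) →ₗ[ℝ] ℝ, g x₀ = p x₀ ∧ ∀ x, g x ≤ p x := by
    rcases eq_or_ne x₀ 0 with rfl | hx₀
    · exact ⟨0, by simp, fun x => apply_nonneg p x⟩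
    · obtain ⟨g, hg, hgp⟩ := exists_extension_of_le_sublinear
        (LinearPMap.mkSpanSingleton x₀ (p x₀) hx₀) p
        (fun c hc x => by rw [map_smul_eq_mul, Real.norm_of_nonneg hc.le]) (map_add_le_add p) (by
          rintro ⟨x, hx⟩
          obtain ⟨c, rfl⟩ := Submodule.mem_span_singleton.1 hx
          rw [LinearPMap.mkSpanSingleton'_apply, map_smul_eq_mul, smul_eq_mul, Real.norm_eq_abs]
          exact mul_le_mul_of_nonneg_right (le_abs_self c) (apply_nonneg p x₀))
      refine ⟨g, ?_, hgp⟩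
      exact (hg ⟨x₀, Submodule.mem_span_singleton_self x₀⟩).trans
        (LinearPMap.mkSpanSingleton_apply ℝ ℝ hx₀ (p x₀))
  have hy : ∀ x, (fun i => g (Pi.single i 1)) ⬝ᵥ x = g x := fun x => by
    conv_rhs => rw [pi_eq_sum_univ' x, map_sum]
    simp [dotProduct, mul_comm]
  refine ⟨fun i => g (Pi.single i 1), (hy x₀).trans hg, fun x => ?_⟩
  rw [hy, abs_le]
  refine ⟨?_, hgp x⟩
  have := hgp (-x)
  rw [map_neg, map_neg_eq_map] at this
  linarith

/-- A finite convex function is continuous in finite dimension, so `p` attains a positive minimum on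
the unit sphere. -/
theorem Seminorm.exists_pos_forall_mul_norm_le {E : Type*} [NormedAddCommGroup E]
    [NormedSpace ℝ E] [FiniteDimensional ℝ E] (p : Seminorm ℝ E) (hp : ∀ x, p x = 0 → x = 0) :
    ∃ c > 0, ∀ x, c * ‖x‖ ≤ p x := by
  have : ProperSpace E := FiniteDimensional.proper ℝ E
  have hcont : Continuous p := by
    rw [← continuousOn_univ]
    exact p.convexOn.continuousOn isOpen_univ
  rcases subsingleton_or_nontrivial E with hE | hE
  · exact ⟨1, one_pos, fun x => by simp [Subsingleton.elim x 0]⟩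
  · obtain ⟨z, hz, hmin⟩ := (isCompact_sphere (0 : E) 1).exists_isMinOn
      (NormedSpace.sphere_nonempty.2 zero_le_one) hcont.continuousOn
    have hz0 : z ≠ 0 := by
      rintro rfl
      simp at hz
    refine ⟨p z, lt_of_le_of_ne (apply_nonneg p z) fun h => hz0 (hp z h.symm), fun x => ?_⟩
    rcases eq_or_ne x 0 with rfl | hx
    · simp
    · have h1 : p z ≤ p (‖x‖⁻¹ • x) := hmin (by simp [norm_smul, hx])
      rw [map_smul_eq_mul, norm_inv, norm_norm] at h1
      rwa [← le_div_iff₀ (norm_pos_iff.2 hx), div_eq_inv_mul]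

theorem dotProduct_sq_le {ι : Type*} [Fintype ι] (x y : ι → ℝ) :
    (x ⬝ᵥ y) ^ 2 ≤ (x ⬝ᵥ x) * (y ⬝ᵥ y) := by
  simpa [dotProduct, sq] using Finset.sum_mul_sq_le_sq_mul_sq Finset.univ x y

theorem dotProduct_self_le_card_mul_norm_sq {ι : Type*} [Fintype ι] (x : ι → ℝ) :
    x ⬝ᵥ x ≤ Fintype.card ι * ‖x‖ ^ 2 := by
  calc x ⬝ᵥ x = ∑ i, ‖x i‖ ^ 2 := by simp [dotProduct, sq]
    _ ≤ ∑ _i : ι, ‖x‖ ^ 2 := by gcongr; exact norm_le_pi_norm x _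
    _ = _ := by simp

/-- A centrally symmetric ellipsoid of minimal volume containing the unit ball of `p`, written
as `{x | ‖B x‖ ≤ 1}`. -/
theorem Seminorm.exists_isMaxOn_det_sq {ι : Type*} [Fintype ι] [DecidableEq ι]
    (p : Seminorm ℝ (ι → ℝ)) (hp : ∀ x, p x = 0 → x = 0) :
    ∃ B : Matrix ι ι ℝ, B.det ≠ 0 ∧ (∀ x, (B *ᵥ x) ⬝ᵥ (B *ᵥ x) ≤ p x ^ 2) ∧
      ∀ C : Matrix ι ι ℝ, (∀ x, (C *ᵥ x) ⬝ᵥ (C *ᵥ x) ≤ p x ^ 2) → C.det ^ 2 ≤ B.det ^ 2 := by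
  set K : Set (Matrix ι ι ℝ) := {B | ∀ x, (B *ᵥ x) ⬝ᵥ (B *ᵥ x) ≤ p x ^ 2} with hK
  have hclosed : IsClosed K := by
    simp only [hK, Set.ofPred_forall]
    exact isClosed_iInter fun x => isClosed_le (by fun_prop) continuous_const
  -- Column `j` of `B` is `B e_j`, so its entries are bounded by `p e_j`.
  have hcompact : IsCompact K := by
    refine (isCompact_univ_pi fun _ : ι => isCompact_univ_pi fun j : ι =>
      isCompact_Icc (a := -p (Pi.single j 1)) (b := p (Pi.single j 1))).of_isClosed_subset
        hclosed ?_
    intro (B : Matrix ι ι ℝ) hB i _ j _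
    refine abs_le.1 (abs_le_of_sq_le_sq ?_ (apply_nonneg p _))
    refine le_trans ?_ (hB (Pi.single j 1))
    rw [mulVec_single_one, dotProduct]
    simp_rw [← sq]
    exact Finset.single_le_sum (f := fun i => (B.col j i) ^ 2) (fun i _ => sq_nonneg _)
      (Finset.mem_univ i)
  obtain ⟨c, hc, hcp⟩ := p.exists_pos_forall_mul_norm_le hp
  -- A small multiple of the identity is admissible, which forces the maximal determinant to be
  -- nonzero.
  obtain ⟨ε, hε, hεc⟩ : ∃ ε : ℝ, 0 < ε ∧ ε ^ 2 * Fintype.card ι ≤ c ^ 2 := by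
    refine ⟨c / (Fintype.card ι + 1), by positivity, ?_⟩
    rw [div_pow, div_mul_eq_mul_div, div_le_iff₀ (by positivity)]
    gcongr
    nlinarith [Nat.cast_nonneg (α := ℝ) (Fintype.card ι)]
  have hεK : ε • (1 : Matrix ι ι ℝ) ∈ K := by
    intro x
    rw [smul_mulVec, one_mulVec, smul_dotProduct, dotProduct_smul, smul_eq_mul, smul_eq_mul,
      ← mul_assoc, ← sq]
    calc ε ^ 2 * (x ⬝ᵥ x) ≤ ε ^ 2 * (Fintype.card ι * ‖x‖ ^ 2) := by
          gcongr; exact dotProduct_self_le_card_mul_norm_sq x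
      _ = ε ^ 2 * Fintype.card ι * ‖x‖ ^ 2 := by ring
      _ ≤ c ^ 2 * ‖x‖ ^ 2 := by gcongr
      _ = (c * ‖x‖) ^ 2 := by ring
      _ ≤ p x ^ 2 := by gcongr; exact hcp x
  obtain ⟨B, hBK, hB⟩ := hcompact.exists_isMaxOn ⟨_, hεK⟩
    (f := fun B : Matrix ι ι ℝ => B.det ^ 2) (by fun_prop)
  refine ⟨B, fun h => ?_, hBK, fun C hC => hB hC⟩
  have h1 : (ε • (1 : Matrix ι ι ℝ)).det ^ 2 ≤ B.det ^ 2 := hB hεK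
  rw [h, det_smul, det_one, mul_one] at h1
  have : 0 < (ε ^ Fintype.card ι) ^ 2 := by positivity
  linarith

/-- First-order comparison at `s = 0`: with `u = 2s + s²c`, the hypothesis gives `u c ≤ exp (n u) -
1 ≤ n u exp (n u)`; divide by `u` and let `s → 0`. -/
theorem le_of_forall_one_add_mul_le_pow {c : ℝ} {n : ℕ}
    (h : ∀ s : ℝ, 0 < s → 1 + (2 * s + s ^ 2 * c) * c ≤ (1 + (2 * s + s ^ 2 * c)) ^ n)
    (hc : 0 ≤ c) : c ≤ n := by
  have ht : Tendsto (fun s : ℝ => n * Real.exp (n * (2 * s + s ^ 2 * c))) (𝓝[>] 0) (𝓝 n) := by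
    have : Continuous fun s : ℝ => n * Real.exp (n * (2 * s + s ^ 2 * c)) := by fun_prop
    simpa using (this.tendsto 0).mono_left nhdsWithin_le_nhds
  refine ge_of_tendsto ht ?_
  filter_upwards [self_mem_nhdsWithin] with s hs
  have hs : 0 < s := hs
  set u := 2 * s + s ^ 2 * c with hu
  have hu0 : 0 < u := by positivity
  have h1 : 1 + u * c ≤ Real.exp (n * u) := by
    refine (h s hs).trans ?_
    rw [Real.exp_nat_mul]
    gcongr
    linarith [Real.add_one_le_exp u]
  have h2 : 1 - n * u ≤ Real.exp (-(n * u)) := by linarith [Real.add_one_le_exp (-(n * u))]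
  have h3 : Real.exp (n * u) * Real.exp (-(n * u)) = 1 := by rw [← Real.exp_add]; simp
  have h4 : Real.exp (n * u) - 1 ≤ n * u * Real.exp (n * u) := by
    nlinarith [Real.exp_pos (n * u)]
  refine le_of_mul_le_mul_left ?_ hu0
  linarith

/-- **John's theorem** for centrally symmetric bodies: every norm on a space of dimension `d` is
within a factor `√d` of a Euclidean norm. -/
theorem Seminorm.exists_det_ne_zero_and_le_card_mul {ι : Type*} [Fintype ι] [DecidableEq ι]
    (p : Seminorm ℝ (ι → ℝ)) (hp : ∀ x, p x = 0 → x = 0) :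
    ∃ B : Matrix ι ι ℝ, B.det ≠ 0 ∧ ∀ x, (B *ᵥ x) ⬝ᵥ (B *ᵥ x) ≤ p x ^ 2 ∧
      p x ^ 2 ≤ Fintype.card ι * ((B *ᵥ x) ⬝ᵥ (B *ᵥ x)) := by
  obtain ⟨B, hB0, hBp, hmax⟩ := p.exists_isMaxOn_det_sq hp
  refine ⟨B, hB0, fun x₀ => ⟨hBp x₀, ?_⟩⟩
  obtain ⟨y, hy₀, hy⟩ := p.exists_dotProduct_eq_and_le x₀
  -- In the coordinates `z = B x` the ellipsoid is the Euclidean ball and the supporting functional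
  -- is `w`; by Cauchy–Schwarz it suffices that `|w|² ≤ d`, where `d` is the dimension.
  obtain ⟨w, rfl⟩ : ∃ w, w ᵥ* B = y :=
    ⟨y ᵥ* B⁻¹, by rw [vecMul_vecMul, nonsing_inv_mul B (isUnit_iff_ne_zero.2 hB0), vecMul_one]⟩
  simp_rw [← dotProduct_mulVec] at hy₀ hy
  have hw0 : 0 ≤ w ⬝ᵥ w := by simpa using dotProduct_self_star_nonneg w
  suffices hw : w ⬝ᵥ w ≤ Fintype.card ι by
    rw [← hy₀]
    refine (dotProduct_sq_le _ _).trans ?_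
    gcongr
    simpa using dotProduct_self_star_nonneg (B *ᵥ x₀)
  refine le_of_forall_one_add_mul_le_pow (fun s hs => ?_) hw0
  set c := w ⬝ᵥ w with hc
  set u := 2 * s + s ^ 2 * c with hu
  have hu0 : 0 < u := by positivity
  -- Since `TᵀT = 1 + u w wᵀ` for the `T` below, `|T B x|² = |B x|² + u (w ⬝ B x)² ≤ (1 + u) (p
  -- x)²`; the factor `r` makes `r T B` a competitor of `B`.
  set r := (√(1 + u))⁻¹ with hr
  have hr2 : r ^ 2 * (1 + u) = 1 := by
    rw [hr, inv_pow, Real.sq_sqrt (by positivity), inv_mul_cancel₀ (by positivity)]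
  set T : Matrix ι ι ℝ := 1 + replicateCol Unit (s • w) * replicateRow Unit w with hT
  have hTdet : T.det = 1 + s * c := by
    rw [hT, det_one_add_replicateCol_mul_replicateRow, dotProduct_smul, smul_eq_mul]
  have hTmul : ∀ z, T *ᵥ z = z + (s * (w ⬝ᵥ z)) • w := fun z => by
    rw [hT, add_mulVec, one_mulVec, ← vecMulVec_eq, vecMulVec_mulVec]
    ext i
    simp
    ring
  have hC : ∀ x, ((r • (T * B)) *ᵥ x) ⬝ᵥ ((r • (T * B)) *ᵥ x) ≤ p x ^ 2 := fun x => by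
    have h1 : ((r • (T * B)) *ᵥ x) ⬝ᵥ ((r • (T * B)) *ᵥ x) =
        r ^ 2 * ((B *ᵥ x) ⬝ᵥ (B *ᵥ x) + u * (w ⬝ᵥ (B *ᵥ x)) ^ 2) := by
      rw [smul_mulVec, ← mulVec_mulVec, hTmul]
      simp only [smul_dotProduct, dotProduct_smul, add_dotProduct, dotProduct_add, smul_eq_mul,
        ← hc, dotProduct_comm (B *ᵥ x) w]
      ring
    have h2 : (w ⬝ᵥ (B *ᵥ x)) ^ 2 ≤ p x ^ 2 := sq_le_sq' (abs_le.1 (hy x)).1 (abs_le.1 (hy x)).2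
    calc _ = _ := h1
      _ ≤ r ^ 2 * (p x ^ 2 + u * p x ^ 2) := by gcongr; exact hBp x
      _ = r ^ 2 * (1 + u) * p x ^ 2 := by ring
      _ = p x ^ 2 := by rw [hr2, one_mul]
  have h := hmax _ hC
  rw [det_smul, det_mul, hTdet, mul_pow, mul_pow, ← mul_assoc] at h
  have h1 : (r ^ Fintype.card ι) ^ 2 * (1 + s * c) ^ 2 ≤ 1 :=
    le_of_mul_le_mul_right (by rwa [one_mul]) (pow_pos (abs_pos.2 hB0) 2 |>.trans_eq (sq_abs _))
  -- Here `u` is such that `(1 + s c)² = 1 + u c`.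
  calc 1 + u * c = (r ^ 2 * (1 + u)) ^ Fintype.card ι * (1 + s * c) ^ 2 := by
        rw [hr2]; ring
    _ = (1 + u) ^ Fintype.card ι * ((r ^ Fintype.card ι) ^ 2 * (1 + s * c) ^ 2) := by
        rw [mul_pow, ← pow_mul, ← pow_mul, mul_comm 2]; ring
    _ ≤ (1 + u) ^ Fintype.card ι := mul_le_of_le_one_right (by positivity) h1

/-! ### Growth of path products and the multinorm of path suprema -/

namespace Switching

variable {V : Type*} {N n : ℕ}

theorem pathMatrix_nil (A : Fin N → Matrix (Fin n) (Fin n) ℝ) :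
    pathMatrix A ([] : List (V × V × Fin N)) = 1 := by
  simp [pathMatrix]

theorem pathMatrix_cons (A : Fin N → Matrix (Fin n) (Fin n) ℝ) (e : V × V × Fin N)
    (p : List (V × V × Fin N)) : pathMatrix A (e :: p) = pathMatrix A p * A e.2.2 := by
  simp [pathMatrix]

theorem cjsr_nonneg [Finite V] (G : LabeledGraph V N) (A : Fin N → Matrix (Fin n) (Fin n) ℝ) :
    0 ≤ cjsr G A :=
  ge_of_tendsto' (tendsto_growthRate_cjsr G A) fun t => Real.sSup_nonneg <| by
    rintro _ ⟨p, -, -, rfl⟩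
    exact Real.rpow_nonneg (norm_nonneg _) _

theorem inducedNorm_rpow_le_growthRate [Finite V] {G : LabeledGraph V N}
    (A : Fin N → Matrix (Fin n) (Fin n) ℝ) {p : List (V × V × Fin N)} (hp : G.IsPath p) :
    inducedNorm (pathMatrix A p) ^ (1 / (p.length : ℝ)) ≤ growthRate G A p.length := by
  refine le_csSup (Set.Finite.bddAbove ?_) ⟨p, hp, rfl, rfl⟩
  refine ((List.finite_length_eq (V × V × Fin N) p.length).image fun q =>
    inducedNorm (pathMatrix A q) ^ (1 / (p.length : ℝ))).subset ?_
  rintro _ ⟨q, -, hq, rfl⟩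
  exact ⟨q, hq, rfl⟩

/-- Path products grow at most like `γ ^ t` for every `γ` above the constrained joint spectral
radius. -/
theorem exists_inducedNorm_le_mul_pow [Finite V] (G : LabeledGraph V N)
    (A : Fin N → Matrix (Fin n) (Fin n) ℝ) {γ : ℝ} (hγ : cjsr G A < γ) :
    ∃ C, ∀ p : List (V × V × Fin N), G.IsPath p →
      inducedNorm (pathMatrix A p) ≤ C * γ ^ p.length := by
  have hγ0 : 0 < γ := (cjsr_nonneg G A).trans_lt hγ
  obtain ⟨T, hT⟩ := eventually_atTop.1 ((tendsto_growthRate_cjsr G A).eventually_lt_const hγ)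
  obtain ⟨C, hC⟩ := ((List.finite_length_lt (V × V × Fin N) (T + 1)).image fun p =>
    inducedNorm (pathMatrix A p) / γ ^ p.length).bddAbove
  -- `C` handles the finitely many paths of length at most `T`, and `1` the longer ones. Their
  -- length is positive, so the root in the growth rate can be undone.
  refine ⟨max C 1, fun p hp => ?_⟩
  rcases lt_or_ge p.length (T + 1) with h | h
  · have h1 := hC ⟨p, h, rfl⟩
    rw [div_le_iff₀ (by positivity)] at h1
    exact h1.trans (by gcongr; exact le_max_left _ _)
  · have h1 := (inducedNorm_rpow_le_growthRate A hp).trans (hT _ (by omega)).le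
    have hl : 0 < (p.length : ℝ) := by exact_mod_cast (by omega : 0 < p.length)
    rw [one_div, Real.rpow_inv_le_iff_of_pos (x := inducedNorm _) (norm_nonneg _) hγ0.le hl, Real.rpow_natCast] at h1
    exact h1.trans (le_mul_of_one_le_left (by positivity) (le_max_right _ _))

/-- The seminorm `x ↦ ‖A_p x‖ / γ ^ |p|`. -/
noncomputable def scaledPathSeminorm (A : Fin N → Matrix (Fin n) (Fin n) ℝ) (γ : ℝ)
    (p : List (V × V × Fin N)) : Seminorm ℝ (Fin n → ℝ) :=
  (normSeminorm ℝ (EuclideanSpace ℝ (Fin n))).comp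
    ((γ ^ p.length)⁻¹ • (WithLp.linearEquiv 2 ℝ (Fin n → ℝ)).symm.toLinearMap ∘ₗ
      (pathMatrix A p).mulVecLin)

theorem scaledPathSeminorm_apply (A : Fin N → Matrix (Fin n) (Fin n) ℝ) {γ : ℝ} (hγ : 0 ≤ γ)
    (p : List (V × V × Fin N)) (x : Fin n → ℝ) :
    scaledPathSeminorm A γ p x = ‖WithLp.toLp 2 (pathMatrix A p *ᵥ x)‖ / γ ^ p.length := by
  have : scaledPathSeminorm A γ p x =
      ‖(γ ^ p.length)⁻¹ • (WithLp.toLp 2 (pathMatrix A p *ᵥ x) : EuclideanSpace ℝ (Fin n))‖ := rfl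
  rw [this, norm_smul, norm_inv, Real.norm_of_nonneg (by positivity), inv_mul_eq_div]

/-- The paths that start at a given node; the empty path starts at every node. -/
def pathsFrom (G : LabeledGraph V N) (v : V) : Set (List (V × V × Fin N)) :=
  {p | G.IsPath p ∧ ∀ e ∈ p.head?, e.1 = v}

theorem nil_mem_pathsFrom (G : LabeledGraph V N) (v : V) : [] ∈ pathsFrom G v := by
  simp [pathsFrom, LabeledGraph.IsPath]

theorem cons_mem_pathsFrom {G : LabeledGraph V N} {v w : V} {σ : Fin N}
    (he : (v, w, σ) ∈ G.edges) {p : List (V × V × Fin N)} (hp : p ∈ pathsFrom G w) :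
    (v, w, σ) :: p ∈ pathsFrom G v := by
  obtain ⟨⟨hpe, hpc⟩, hpw⟩ := hp
  refine ⟨⟨?_, List.isChain_cons.2 ⟨fun e he => (hpw e he).symm, hpc⟩⟩, by simp⟩
  simpa [he] using hpe

/-- Needed for the supremum of seminorms to be the pointwise one: an unbounded family gets the zero
seminorm as its supremum. -/
theorem bddAbove_scaledPathSeminorm [Finite V] (G : LabeledGraph V N)
    (A : Fin N → Matrix (Fin n) (Fin n) ℝ) {γ : ℝ} (hγ : cjsr G A < γ) (v : V) :
    BddAbove (Set.range fun p : pathsFrom G v => scaledPathSeminorm A γ p.1) := by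
  have hγ0 : 0 < γ := (cjsr_nonneg G A).trans_lt hγ
  obtain ⟨C, hC⟩ := exists_inducedNorm_le_mul_pow G A hγ
  rw [Seminorm.bddAbove_range_iff]
  refine fun x => ⟨C * ‖WithLp.toLp 2 x‖, ?_⟩
  rintro _ ⟨p, rfl⟩
  simp only [scaledPathSeminorm_apply A hγ0.le]
  rw [div_le_iff₀ (by positivity)]
  calc _ = ‖toEuclideanCLM (n := Fin n) (𝕜 := ℝ) (pathMatrix A p.1) (WithLp.toLp 2 x)‖ := by
        rw [toEuclideanCLM_toLp]
    _ ≤ inducedNorm (pathMatrix A p.1) * ‖WithLp.toLp 2 x‖ := ContinuousLinearMap.le_opNorm _ _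
    _ ≤ C * γ ^ p.1.length * ‖WithLp.toLp 2 x‖ := by gcongr; exact hC p.1 p.2.1
    _ = _ := by ring

/-- For every `γ` above the constrained joint spectral radius there is a `γ`-multinorm. -/
theorem exists_isMultinorm_of_cjsr_lt [Finite V] (G : LabeledGraph V N)
    (A : Fin N → Matrix (Fin n) (Fin n) ℝ) {γ : ℝ} (hγ : cjsr G A < γ) :
    ∃ ν : V → Seminorm ℝ (Fin n → ℝ), IsMultinorm G A γ ν := by
  have hγ0 : 0 < γ := (cjsr_nonneg G A).trans_lt hγ
  have hbdd := bddAbove_scaledPathSeminorm G A hγ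
  have hle : ∀ v, ∀ p ∈ pathsFrom G v, ∀ x, scaledPathSeminorm A γ p x ≤
      (⨆ q : pathsFrom G v, scaledPathSeminorm A γ q.1) x := fun v p hp x =>
    le_ciSup (hbdd v) ⟨p, hp⟩ x
  refine ⟨fun v => ⨆ p : pathsFrom G v, scaledPathSeminorm A γ p.1, fun v x hx => ?_,
    fun v w σ he x => ?_⟩
  -- The empty path contributes the Euclidean norm itself.
  · have h := hle v [] (nil_mem_pathsFrom G v) x
    rw [hx, scaledPathSeminorm_apply A hγ0.le] at h
    simpa [pathMatrix_nil] using h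
  · rw [Seminorm.iSup_apply (hbdd w)]
    have : Nonempty (pathsFrom G w) := ⟨[], nil_mem_pathsFrom G w⟩
    refine ciSup_le fun p => ?_
    have h := hle v _ (cons_mem_pathsFrom he p.2) x
    rw [scaledPathSeminorm_apply A hγ0.le, pathMatrix_cons, ← mulVec_mulVec, List.length_cons,
      div_le_iff₀ (by positivity)] at h
    rw [scaledPathSeminorm_apply A hγ0.le, div_le_iff₀ (by positivity)]
    calc _ ≤ _ := h
      _ = _ := by ring

end Switching

/-! ### Passage to quadratic norms -/

namespace Switching

variable {V : Type*} {N n : ℕ}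

theorem exists_isQuadraticNorm_le_and_le (p : Seminorm ℝ (Fin n → ℝ)) (hp : ∀ x, p x = 0 → x = 0) :
    ∃ q : Seminorm ℝ (Fin n → ℝ), IsQuadraticNorm q ∧ (∀ x, q x = 0 → x = 0) ∧
      ∀ x, q x ≤ p x ∧ p x ≤ √n * q x := by
  obtain ⟨B, hB0, hB⟩ := p.exists_det_ne_zero_and_le_card_mul hp
  have hinj : Function.Injective B.mulVec :=
    mulVec_injective_iff_isUnit.2 ((isUnit_iff_isUnit_det B).2 (isUnit_iff_ne_zero.2 hB0))
  let q : Seminorm ℝ (Fin n → ℝ) := (normSeminorm ℝ (EuclideanSpace ℝ (Fin n))).comp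
    ((WithLp.linearEquiv 2 ℝ (Fin n → ℝ)).symm.toLinearMap ∘ₗ B.mulVecLin)
  have hq : ∀ x, q x = √((B *ᵥ x) ⬝ᵥ (B *ᵥ x)) := fun x => by
    change ‖(WithLp.toLp 2 (B *ᵥ x) : EuclideanSpace ℝ (Fin n))‖ = _
    rw [EuclideanSpace.norm_eq]
    simp [dotProduct, sq]
  refine ⟨q, ⟨Bᴴ * B, PosDef.conjTranspose_mul_self B hinj, fun x => ?_⟩, fun x hx => ?_,
    fun x => ⟨?_, ?_⟩⟩
  · rw [hq, ← mulVec_mulVec, dotProduct_mulVec x, conjTranspose_eq_transpose_of_trivial,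
      vecMul_transpose]
  · rw [hq, Real.sqrt_eq_zero (by simpa using dotProduct_self_star_nonneg (B *ᵥ x)), dotProduct_self_eq_zero] at hx
    exact hinj (hx.trans (mulVec_zero B).symm)
  · rw [hq]
    exact Real.sqrt_le_iff.2 ⟨apply_nonneg p x, (hB x).1⟩
  · rw [hq, ← Real.sqrt_mul (Nat.cast_nonneg n)]
    exact Real.le_sqrt_of_sq_le (by simpa using (hB x).2)

/-- The lower John bound is used at the head of the edge and the upper one at its tail, so only one
factor `√n` is lost. -/
theorem exists_isQuadraticMultinorm_of_isMultinorm {G : LabeledGraph V N}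
    {A : Fin N → Matrix (Fin n) (Fin n) ℝ} {γ : ℝ} (hγ : 0 ≤ γ)
    {ν : V → Seminorm ℝ (Fin n → ℝ)} (hν : IsMultinorm G A γ ν) :
    ∃ μ : V → Seminorm ℝ (Fin n → ℝ), IsQuadraticMultinorm G A (√n * γ) μ := by
  choose μ hquad hdef hμ using fun v => exists_isQuadraticNorm_le_and_le (ν v) (hν.1 v)
  refine ⟨μ, ⟨hdef, fun v w σ he x => ?_⟩, hquad⟩
  calc μ w (A σ *ᵥ x) ≤ ν w (A σ *ᵥ x) := (hμ w _).1
    _ ≤ γ * ν v x := hν.2 v w σ he x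
    _ ≤ γ * (√n * μ v x) := by gcongr; exact (hμ v x).2
    _ = √n * γ * μ v x := by ring

end Switching

theorem theorem4p5 {V : Type*} [Finite V] {N n : ℕ} (hn : 1 ≤ n)
    (G : LabeledGraph V N) (A : Fin N → Matrix (Fin n) (Fin n) ℝ) :
    (Switching.cjsr G A < 1 / √(n : ℝ) →
      ∃ ν : V → Seminorm ℝ (Fin n → ℝ), Switching.IsQuadraticLyapunovMultinorm G A ν) ∧
    ∀ ε : ℝ, 0 < ε → ∃ γ : ℝ, γ ≤ √(n : ℝ) * (Switching.cjsr G A + ε) ∧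
      ∃ ν : V → Seminorm ℝ (Fin n → ℝ), Switching.IsQuadraticMultinorm G A γ ν := by
  have key : ∀ γ, Switching.cjsr G A < γ →
      ∃ ν : V → Seminorm ℝ (Fin n → ℝ), Switching.IsQuadraticMultinorm G A (√n * γ) ν := by
    intro γ hγ
    obtain ⟨ν, hν⟩ := Switching.exists_isMultinorm_of_cjsr_lt G A hγ
    exact Switching.exists_isQuadraticMultinorm_of_isMultinorm
      ((Switching.cjsr_nonneg G A).trans hγ.le) hν
  refine ⟨fun h => ?_, fun ε hε => ⟨_, le_rfl, key _ (lt_add_of_pos_right _ hε)⟩⟩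
  obtain ⟨γ, hγ, hγn⟩ := exists_between h
  obtain ⟨ν, hν⟩ := key γ hγ
  have hn0 : 0 < √(n : ℝ) := Real.sqrt_pos.2 (by exact_mod_cast hn)
  refine ⟨ν, √n * γ, ?_, hν⟩
  rwa [lt_div_iff₀ hn0, mul_comm] at hγn
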